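/- Let $n\ge 1$, $m\ge 2$ be integers and let $\mathbb F_n^+$ be the free monoid on $g_1,\dots,g_n$, with identity $g_0$ and word length $|\alpha|$. For an integer $N\ge 1$ let $F^2(H_N)$ be the full Fock space of an $N$-dimensional complex Hilbert space $H_N$ with orthonormal basis $e_1,\dots,e_N$, and let $S_i\varphi=e_i\otimes\varphi$ ($1\le i\le N$) be the left creation operators on it. The numerical radius of a bounded operator $T$ is $\omega(T)=\sup\{|\langle Th,h\rangle|:\|h\|=1\}$, and the joint numerical radius of bounded operators $X_1,\dots,X_N$ on a complex Hilbert space is $$w(X_1,\dots,X_N)=\omega\big(S_1\otimes X_1^*+\cdots+S_N\otimes X_N^*\big),$$ where $S_1,\dots,S_N$ act on $F^2(H_N)$. For each $m\ge 2$ the equation $$\sum_{k=1}^{m-1}t^k\cos\frac{\pi}{\left[\frac{m-1}{k}\right]+2}=\frac12 ,$$ where $[x]$ is the integer part of $x$, has a unique solution $t=t_m$ in $(0,1]$. The sequence $(t_m)_{m\ge2}$ is strictly decreasing and converges to $\frac13$. Let $\mathcal H$ be a complex Hilbert space and let $$F(S_1,\dots,S_n)=\sum_{k=0}^{m-1}\sum_{|\alpha|=k}S_\alpha\otimes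 A_{(\alpha)},\qquad A_{(\alpha)}\in B(\mathcal H),$$ with $S_1,\dots,S_n$ the left creation operators on $F^2(H_n)$, and $S_\alpha=S_{i_1}\cdots S_{i_k}$ for $\alpha=g_{i_1}\cdots g_{i_k}$, $S_{g_0}=I$. Put $A_{(0)}=A_{(g_0)}$. If $F(0)=A_{(0)}\ge 0$ and $\operatorname{Re}F(S_1,\dots,S_n)\le I$, then $$w\big(A_{(\alpha)}^*:|\alpha|=k\big)\le 2\,\|I-A_{(0)}\|\cos\frac{\pi}{\left[\frac{m-1}{k}\right]+2}\qquad(1\le k\le m-1)$$ and $$\sum_{k=0}^{m-1}r^k\,w\big(A_{(\alpha)}^*:|\alpha|=k\big)\le\|A_{(0)}\|+\|I-A_{(0)}\|\qquad\text{for every } r\in[0,t_m].$$ -/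

import Mathlib

open scoped TensorProduct

noncomputable section

namespace BohrPoly

/-- The full Fock space `F²(H_N)` of the Hilbert space `H_N` with orthonormal basis
`(e_i)_{i ∈ ι}`, `N = card ι`.  The vectors `e_α = e_{i₁} ⊗ ⋯ ⊗ e_{i_k}`, indexed by the words
`α = g_{i₁} ⋯ g_{i_k}` of the free monoid on `ι`, are an orthonormal basis of it, so that it is
the space of square-summable families of coefficients `(c_α)_α`. -/
abbrev Fock (ι : Type*) : Type _ := lp (fun _ : FreeMonoid ι => ℂ) 2

/-- The Hilbert tensor product of two complex inner product spaces: the completion of the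
algebraic tensor product, with `⟪x ⊗ y, x' ⊗ y'⟫ = ⟪x, x'⟫ ⟪y, y'⟫`. -/
abbrev HilbertTensor (E F : Type*) [NormedAddCommGroup E] [InnerProductSpace ℂ E]
    [NormedAddCommGroup F] [InnerProductSpace ℂ F] : Type _ :=
  UniformSpace.Completion (E ⊗[ℂ] F)

/-- The tensor product `T ⊗ A` of two bounded operators: the bounded operator on the Hilbert
tensor product with `(T ⊗ A) (x ⊗ y) = T x ⊗ A y`. -/
def opTensor {E F : Type*} [NormedAddCommGroup E] [InnerProductSpace ℂ E]
    [NormedAddCommGroup F] [InnerProductSpace ℂ F] (T : E →L[ℂ] E) (A : F →L[ℂ] F) :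
    HilbertTensor E F →L[ℂ] HilbertTensor E F :=
  (TensorProduct.mapL T A).completion

theorem of_mul_injective {ι : Type*} (i : ι) :
    Function.Injective (fun α : FreeMonoid ι => FreeMonoid.of i * α) :=
  fun _ _ h => mul_left_cancel h

/-- The coefficients of `e_i ⊗ φ`: the coefficient at `g_i α` is the coefficient of `φ` at `α`,
and the coefficients at words that do not begin with `g_i` vanish. -/
def creationFun {ι : Type*} (i : ι) (φ : FreeMonoid ι → ℂ) : FreeMonoid ι → ℂ :=
  Function.extend (fun α => FreeMonoid.of i * α) φ 0

theorem creationFun_norm_sq {ι : Type*} (i : ι) (φ : FreeMonoid ι → ℂ) :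
    (fun γ => ‖creationFun i φ γ‖ ^ (2 : ENNReal).toReal) =
      Function.extend (fun α => FreeMonoid.of i * α)
        (fun α => ‖φ α‖ ^ (2 : ENNReal).toReal) 0 := by
  funext γ
  by_cases h : ∃ α, FreeMonoid.of i * α = γ
  · obtain ⟨α, rfl⟩ := h
    simp only [creationFun, (of_mul_injective i).extend_apply]
  · simp only [creationFun, Function.extend_apply' _ _ _ h]
    simp

theorem creationFun_memℓp {ι : Type*} (i : ι) (φ : Fock ι) :
    Memℓp (E := fun _ : FreeMonoid ι => ℂ) (creationFun i φ) 2 := by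
  apply memℓp_gen
  rw [creationFun_norm_sq]
  exact ((hasSum_extend_zero (of_mul_injective i)).2
    ((memℓp_gen_iff (by norm_num)).1 (lp.memℓp φ)).hasSum).summable

theorem creationFun_add {ι : Type*} (i : ι) (φ ψ : FreeMonoid ι → ℂ) :
    creationFun i (φ + ψ) = creationFun i φ + creationFun i ψ := by
  funext γ
  by_cases h : ∃ α, FreeMonoid.of i * α = γ
  · obtain ⟨α, rfl⟩ := h
    simp only [creationFun, Pi.add_apply, (of_mul_injective i).extend_apply]
  · simp only [creationFun, Pi.add_apply, Function.extend_apply' _ _ _ h, Pi.zero_apply, add_zero]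

theorem creationFun_smul {ι : Type*} (i : ι) (c : ℂ) (φ : FreeMonoid ι → ℂ) :
    creationFun i (c • φ) = c • creationFun i φ := by
  funext γ
  by_cases h : ∃ α, FreeMonoid.of i * α = γ
  · obtain ⟨α, rfl⟩ := h
    simp only [creationFun, Pi.smul_apply, (of_mul_injective i).extend_apply]
  · simp only [creationFun, Pi.smul_apply, Function.extend_apply' _ _ _ h, Pi.zero_apply,
      smul_zero]

/-- The left creation operator `S_i φ = e_i ⊗ φ` on the full Fock space, as an isometry. -/
def creationIsometry {ι : Type*} (i : ι) : Fock ι →ₗᵢ[ℂ] Fock ι where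
  toFun φ := ⟨creationFun i φ, creationFun_memℓp i φ⟩
  map_add' φ ψ := Subtype.ext (creationFun_add i φ ψ)
  map_smul' c φ := Subtype.ext (creationFun_smul i c φ)
  norm_map' φ := by
    have h2 : 0 < (2 : ENNReal).toReal := by norm_num
    rw [lp.norm_eq_tsum_rpow h2, lp.norm_eq_tsum_rpow h2]
    congr 1
    change ∑' γ, ‖creationFun i φ γ‖ ^ (2 : ENNReal).toReal = _
    rw [creationFun_norm_sq]
    exact ((hasSum_extend_zero (of_mul_injective i)).2
      ((memℓp_gen_iff h2).1 (lp.memℓp φ)).hasSum).tsum_eq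

/-- The left creation operator `S_i φ = e_i ⊗ φ` on the full Fock space. -/
def creation {ι : Type*} (i : ι) : Fock ι →L[ℂ] Fock ι :=
  (creationIsometry i).toContinuousLinearMap

/-- `S_α = S_{i₁} ⋯ S_{i_k}` for a word `α = g_{i₁} ⋯ g_{i_k}`, and `S_{g₀} = I`. -/
def creationWord {ι : Type*} : FreeMonoid ι →* (Fock ι →L[ℂ] Fock ι) :=
  FreeMonoid.lift creation

/-- The word `g_{i₁} ⋯ g_{i_k}` of length `k`.  Every word of length `k` is of this form for
exactly one `(i₁, …, i_k)`. -/
def word {ι : Type*} {k : ℕ} (i : Fin k → ι) : FreeMonoid ι :=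
  FreeMonoid.ofList (List.ofFn i)

/-- The polynomial `F(S₁, …, S_n) = ∑_{k=0}^{m-1} ∑_{|α|=k} S_α ⊗ A_(α)`. -/
def polyOp {n : ℕ} {H : Type*} [NormedAddCommGroup H] [InnerProductSpace ℂ H]
    (m : ℕ) (A : FreeMonoid (Fin n) → (H →L[ℂ] H)) :
    HilbertTensor (Fock (Fin n)) H →L[ℂ] HilbertTensor (Fock (Fin n)) H :=
  ∑ k ∈ Finset.range m, ∑ i : Fin k → Fin n, opTensor (creationWord (word i)) (A (word i))

/-- The numerical radius `ω(T) = sup {|⟪T h, h⟫| : ‖h‖ = 1}`. -/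
def numRadius {E : Type*} [NormedAddCommGroup E] [InnerProductSpace ℂ E]
    (T : E →L[ℂ] E) : ℝ :=
  sSup {x : ℝ | ∃ h : E, ‖h‖ = 1 ∧ x = ‖inner ℂ (T h) h‖}

/-- The joint numerical radius `w(X_i : i ∈ ι) = ω(∑_i S_i ⊗ X_i^*)` of a finite family of
bounded operators, `S_i` being the left creation operators on the full Fock space of a Hilbert
space with orthonormal basis `(e_i)_{i ∈ ι}`. -/
def jointNumRadius {ι : Type*} [Fintype ι] {H : Type*} [NormedAddCommGroup H]
    [InnerProductSpace ℂ H] [CompleteSpace H] (X : ι → (H →L[ℂ] H)) : ℝ :=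
  numRadius (∑ i, opTensor (creation i) (ContinuousLinearMap.adjoint (X i)))

/-- `w(A_(α)^* : |α| = k)`. -/
def coeffRadius {n : ℕ} {H : Type*} [NormedAddCommGroup H] [InnerProductSpace ℂ H]
    [CompleteSpace H] (A : FreeMonoid (Fin n) → (H →L[ℂ] H)) (k : ℕ) : ℝ :=
  jointNumRadius fun i : Fin k → Fin n => ContinuousLinearMap.adjoint (A (word i))

/-- The Fejér constant `cos (π / ([(m-1)/k] + 2))`, with `[x]` the integer part of `x`. -/
def fejerConst (m k : ℕ) : ℝ :=
  Real.cos (Real.pi / ((⌊((m : ℝ) - 1) / (k : ℝ)⌋ : ℝ) + 2))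

end BohrPoly

end

/-!
The gauge rotation `e_α ↦ u ^ (-|α|) e_α` of the Fock space turns `⟪x, F x⟫` into the scalar
trigonometric polynomial `∑ k, u ^ k ⟪x, F_k x⟫`, where `F_k` is the part of `F` of degree `k`.
Its real part is at most `‖x‖ ^ 2`, so the Egerváry–Szász inequality bounds its coefficients. That
inequality comes from the quadrature at the `kN`-th roots of `-1` with the nonnegative weights
`cos (π / N) - Re z ^ k`, which sees only the frequencies `0` and `k` of the polynomial.
Concatenating words of length `k` embeds the Fock space over the alphabet of these words
isometrically in `F²(H_n)` and intertwines the creation operators with the `S_α`, `|α| = k`; hence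
the joint numerical radius of the coefficients of degree `k` is at most the numerical radius of
`F_k`.

The limit of `t_m` is `1 / 3` because the polynomials that define `t_m` increase with `m` to the
geometric series `∑ k ≥ 1, t ^ k`, which equals `1 / 2` at `t = 1 / 3`.
-/

noncomputable section

namespace BohrPoly

section Trigonometric

open Finset

theorem sum_zpow_odd_pow_eq_zero {K : Type*} [Field K] {ζ : K} {L : ℕ}
    (hζ : IsPrimitiveRoot ζ (2 * L)) {l : ℤ} (hl : l ≠ 0) (hlL : |l| < L) :
    ∑ j ∈ range L, (ζ ^ (2 * j + 1)) ^ l = 0 := by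
  have hL : L ≠ 0 := by have := abs_nonneg l; lia
  have hζ0 : ζ ≠ 0 := hζ.ne_zero (by lia)
  have hpow : (ζ ^ (2 * l)) ^ L = 1 := by
    rw [← zpow_natCast, ← zpow_mul, hζ.zpow_eq_one_iff_dvd]
    exact ⟨l, by push_cast; ring⟩
  have hne : ζ ^ (2 * l) ≠ 1 := by
    rw [Ne, hζ.zpow_eq_one_iff_dvd, Nat.cast_mul, Nat.cast_ofNat,
      mul_dvd_mul_iff_left two_ne_zero]
    exact fun h => hl (Int.eq_zero_of_abs_lt_dvd h hlL)
  calc ∑ j ∈ range L, (ζ ^ (2 * j + 1)) ^ l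
      = ζ ^ l * ∑ j ∈ range L, (ζ ^ (2 * l)) ^ j := by
        rw [mul_sum]
        refine sum_congr rfl fun j _ => ?_
        simp only [← zpow_natCast, ← zpow_mul, ← zpow_add₀ hζ0]
        congr 1
        push_cast
        ring
    _ = 0 := by rw [geom_sum_eq hne, hpow, sub_self, zero_div, mul_zero]

/-- The nodes of the quadrature on the circle: the `L`-th roots of `-1`. -/
def oddNode (L j : ℕ) : Circle :=
  Circle.exp (Real.pi / L) ^ (2 * j + 1)

theorem isPrimitiveRoot_circleExp_pi_div {L : ℕ} (hL : L ≠ 0) :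
    IsPrimitiveRoot (Circle.exp (Real.pi / L) : ℂ) (2 * L) := by
  convert Complex.isPrimitiveRoot_exp (2 * L) (by lia) using 1
  rw [Circle.coe_exp]
  congr 1
  push_cast
  field_simp

theorem sum_oddNode_zpow {L : ℕ} {l : ℤ} (hl : |l| < L) :
    ∑ j ∈ range L, (oddNode L j : ℂ) ^ l = if l = 0 then (L : ℂ) else 0 := by
  have hL : L ≠ 0 := by have := abs_nonneg l; lia
  split_ifs with h0
  · simp [h0]
  · simp only [oddNode, Circle.coe_pow]
    exact sum_zpow_odd_pow_eq_zero (isPrimitiveRoot_circleExp_pi_div hL) h0 hl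

theorem re_oddNode_pow (L j k : ℕ) :
    ((oddNode L j : ℂ) ^ k).re = Real.cos ((2 * j + 1) * (k * Real.pi / L)) := by
  rw [oddNode, Circle.coe_pow, Circle.coe_exp, ← Complex.exp_nat_mul, ← Complex.exp_nat_mul,
    ← Complex.exp_ofReal_mul_I_re]
  congr 2
  push_cast
  ring

theorem ofReal_re_pow (z : Circle) (k : ℕ) :
    ((((z : ℂ) ^ k).re : ℝ) : ℂ) = ((z : ℂ) ^ (k : ℤ) + (z : ℂ) ^ (-k : ℤ)) / 2 := by
  rw [Complex.re_eq_add_conj, zpow_natCast, zpow_neg, zpow_natCast, ← Circle.coe_pow,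
    ← Circle.coe_inv, Circle.coe_inv_eq_conj]

theorem sin_mul_pi_div_mul_sin_succ_nonneg {N : ℕ} (hN : N ≠ 0) (j : ℕ) :
    0 ≤ Real.sin (j * (Real.pi / N)) * Real.sin ((j + 1) * (Real.pi / N)) := by
  have : (0 : ℝ) < N := by positivity
  have hrN : ((j % N : ℕ) : ℝ) + 1 ≤ N := by exact_mod_cast Nat.mod_lt j (by lia)
  have hj : (j : ℝ) = N * (j / N : ℕ) + (j % N : ℕ) := by exact_mod_cast (Nat.div_add_mod j N).symm
  have hsin (x : ℝ) : Real.sin ((N * (j / N : ℕ) + x) * (Real.pi / N)) =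
      (-1) ^ (j / N) * Real.sin (x * (Real.pi / N)) := by
    rw [← Real.sin_add_nat_mul_pi]
    congr 1
    field_simp
    ring
  have hnonneg {x : ℝ} (h0 : 0 ≤ x) (h1 : x ≤ N) : 0 ≤ Real.sin (x * (Real.pi / N)) := by
    refine Real.sin_nonneg_of_nonneg_of_le_pi (by positivity) ?_
    calc x * (Real.pi / N) ≤ N * (Real.pi / N) := by gcongr
      _ = Real.pi := by field_simp
  rw [hj, add_assoc, hsin, hsin, mul_mul_mul_comm, ← mul_pow, neg_one_mul, neg_neg, one_pow,
    one_mul]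
  exact mul_nonneg (hnonneg (by positivity) (by linarith)) (hnonneg (by positivity) hrN)

theorem cos_odd_mul_pi_div_le {N : ℕ} (hN : N ≠ 0) (j : ℕ) :
    Real.cos ((2 * j + 1) * (Real.pi / N)) ≤ Real.cos (Real.pi / N) := by
  rw [← sub_nonneg, Real.cos_sub_cos]
  have h := sin_mul_pi_div_mul_sin_succ_nonneg hN j
  rw [show (Real.pi / N + (2 * j + 1) * (Real.pi / N)) / 2 = (j + 1) * (Real.pi / N) by ring,
    show (Real.pi / N - (2 * j + 1) * (Real.pi / N)) / 2 = -(j * (Real.pi / N)) by ring,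
    Real.sin_neg]
  linarith

/-- The weight at the node `z = oddNode (k * N) j` of the quadrature that extracts the `k`-th
coefficient of a trigonometric polynomial: the value of `cos (π / N) - Re zᵏ`. -/
def fejerWeight (k N j : ℕ) : ℝ :=
  Real.cos (Real.pi / N) - ((oddNode (k * N) j : ℂ) ^ k).re

theorem fejerWeight_nonneg {k N : ℕ} (hk : k ≠ 0) (hN : N ≠ 0) (j : ℕ) :
    0 ≤ fejerWeight k N j := by
  have hangle : (k : ℝ) * Real.pi / (k * N : ℕ) = Real.pi / N := by push_cast; field_simp
  rw [fejerWeight, sub_nonneg, re_oddNode_pow, hangle]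
  exact cos_odd_mul_pi_div_le hN j

theorem sum_fejerWeight_mul_oddNode_pow {k N l : ℕ} (hk : k ≠ 0) (hl : l + k < k * N) :
    ∑ j ∈ range (k * N), (fejerWeight k N j : ℂ) * (oddNode (k * N) j : ℂ) ^ l =
      (k * N : ℕ) * ((if l = 0 then (Real.cos (Real.pi / N) : ℂ) else 0) -
        if l = k then 1 / 2 else 0) := by
  have hsplit (j : ℕ) :
      (fejerWeight k N j : ℂ) * (oddNode (k * N) j : ℂ) ^ l =
        Real.cos (Real.pi / N) * (oddNode (k * N) j : ℂ) ^ (l : ℤ) -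
          ((oddNode (k * N) j : ℂ) ^ (l + k : ℤ) + (oddNode (k * N) j : ℂ) ^ (l - k : ℤ)) / 2 := by
    rw [fejerWeight, Complex.ofReal_sub, ofReal_re_pow, sub_eq_add_neg (l : ℤ),
      zpow_add₀ (Circle.coe_ne_zero _), zpow_add₀ (Circle.coe_ne_zero _), ← zpow_natCast _ l]
    ring
  simp only [hsplit, sum_sub_distrib, ← mul_sum, ← sum_div, sum_add_distrib]
  rw [sum_oddNode_zpow (abs_lt.2 ⟨by lia, by lia⟩), sum_oddNode_zpow (abs_lt.2 ⟨by lia, by lia⟩),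
    sum_oddNode_zpow (abs_lt.2 ⟨by lia, by lia⟩)]
  have hsub : (l : ℤ) - k = 0 ↔ l = k := by lia
  have hadd : (l : ℤ) + k ≠ 0 := by lia
  simp only [hsub, hadd, Nat.cast_eq_zero, if_false]
  split_ifs <;> ring

theorem sum_fejerWeight {k N : ℕ} (hk : k ≠ 0) (hN : 1 < N) :
    ∑ j ∈ range (k * N), fejerWeight k N j = (k * N : ℕ) * Real.cos (Real.pi / N) := by
  have h := sum_fejerWeight_mul_oddNode_pow (N := N) (l := 0) hk (by nlinarith [hk.pos])
  simp only [pow_zero, mul_one, if_true, hk.symm, if_false, sub_zero] at h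
  exact_mod_cast h

theorem sum_fejerWeight_mul_sum_pow {m k N : ℕ} (hk : k ≠ 0) (hkm : k < m)
    (hmN : m + k ≤ k * N) (a : Circle) (c : ℕ → ℂ) :
    ∑ j ∈ range (k * N), (fejerWeight k N j : ℂ) *
        ∑ l ∈ range m, ((a * oddNode (k * N) j : Circle) : ℂ) ^ l * c l =
      (k * N : ℕ) * (Real.cos (Real.pi / N) * c 0 - (a : ℂ) ^ k * c k / 2) := by
  calc _ = ∑ l ∈ range m, (a : ℂ) ^ l * c l *
          ∑ j ∈ range (k * N), (fejerWeight k N j : ℂ) * (oddNode (k * N) j : ℂ) ^ l := by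
        simp only [mul_sum]
        rw [sum_comm]
        refine sum_congr rfl fun l _ => sum_congr rfl fun j _ => ?_
        rw [Circle.coe_mul, mul_pow]
        ring
    _ = ∑ l ∈ range m, (a : ℂ) ^ l * c l * ((k * N : ℕ) *
          ((if l = 0 then (Real.cos (Real.pi / N) : ℂ) else 0) - if l = k then 1 / 2 else 0)) :=
        sum_congr rfl fun l hl => by
          have := mem_range.1 hl
          rw [sum_fejerWeight_mul_oddNode_pow hk (by lia)]
    _ = _ := by
        simp only [mul_sub, mul_ite, mul_zero, sum_sub_distrib, sum_ite_eq', mem_range, hkm,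
          show 0 < m by lia, if_true, pow_zero]
        ring

theorem exists_circle_pow_mul_eq_norm {k : ℕ} (hk : k ≠ 0) (c : ℂ) :
    ∃ a : Circle, (a : ℂ) ^ k * c = ‖c‖ := by
  refine ⟨Circle.exp (-(c.arg / k)), ?_⟩
  have hk' : (k : ℂ) ≠ 0 := by exact_mod_cast hk
  nth_rewrite 2 [← Complex.norm_mul_exp_arg_mul_I c]
  rw [Circle.coe_exp, ← Complex.exp_nat_mul, mul_left_comm, ← Complex.exp_add]
  have hcancel : k * (((-(c.arg / k) : ℝ) : ℂ) * Complex.I) + c.arg * Complex.I = 0 := by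
    push_cast
    field_simp
    ring
  rw [hcancel, Complex.exp_zero, mul_one]

/-- The Egerváry–Szász inequality. -/
theorem norm_coeff_le_of_re_sum_le {m k N : ℕ} (hkm : k < m) (hmN : m + k ≤ k * N) {c : ℕ → ℂ}
    {M : ℝ} (h : ∀ u : Circle, (∑ l ∈ range m, (u : ℂ) ^ l * c l).re ≤ M) :
    ‖c k‖ ≤ 2 * (M - (c 0).re) * Real.cos (Real.pi / N) := by
  have hk : k ≠ 0 := by rintro rfl; lia
  have hN : 1 < N := by by_contra! hN; have := Nat.mul_le_mul_left k hN; lia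
  obtain ⟨a, ha⟩ := exists_circle_pow_mul_eq_norm hk (-c k)
  rw [mul_neg, norm_neg, neg_eq_iff_eq_neg] at ha
  have hL : (0 : ℝ) < (k * N : ℕ) := by positivity
  have hquad : ∑ j ∈ range (k * N),
      fejerWeight k N j * (∑ l ∈ range m, ((a * oddNode (k * N) j : Circle) : ℂ) ^ l * c l).re =
        (k * N : ℕ) * (Real.cos (Real.pi / N) * (c 0).re + ‖c k‖ / 2) := by
    simp only [← Complex.re_ofReal_mul, ← Complex.re_sum]
    rw [sum_fejerWeight_mul_sum_pow hk hkm hmN, ha, neg_div, sub_neg_eq_add,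
      ← Complex.ofReal_natCast, Complex.re_ofReal_mul, Complex.add_re, Complex.re_ofReal_mul,
      ← Complex.ofReal_ofNat, ← Complex.ofReal_div, Complex.ofReal_re]
  have hbound : ∑ j ∈ range (k * N),
      fejerWeight k N j * (∑ l ∈ range m, ((a * oddNode (k * N) j : Circle) : ℂ) ^ l * c l).re ≤
        (k * N : ℕ) * (Real.cos (Real.pi / N) * M) := by
    rw [← mul_assoc, ← sum_fejerWeight hk hN, sum_mul]
    exact sum_le_sum fun j _ =>
      mul_le_mul_of_nonneg_left (h _) (fejerWeight_nonneg hk (by lia) j)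
  rw [hquad] at hbound
  linarith [le_of_mul_le_mul_left hbound hL]

end Trigonometric

section FejerRoot

open Finset Filter

theorem fejerConst_eq {m : ℕ} (hm : m ≠ 0) (k : ℕ) :
    fejerConst m k = Real.cos (Real.pi / ((m - 1) / k + 2 : ℕ)) := by
  have hfloor : ⌊((m : ℝ) - 1) / k⌋ = ((m - 1) / k : ℕ) := by
    rw [← Nat.cast_pred hm.pos, ← Int.natCast_floor_eq_floor (by positivity),
      Nat.floor_div_eq_div]
  rw [fejerConst, hfloor]
  push_cast
  rfl

theorem cos_pi_div_le_cos_pi_div {x y : ℝ} (hx : 1 ≤ x) (hxy : x ≤ y) :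
    Real.cos (Real.pi / x) ≤ Real.cos (Real.pi / y) :=
  Real.cos_le_cos_of_nonneg_of_le_pi (div_nonneg Real.pi_pos.le (by linarith))
    (div_le_self Real.pi_pos.le hx) (by gcongr)

theorem fejerConst_mono {m m' : ℕ} (hm : m ≠ 0) (h : m ≤ m') (k : ℕ) :
    fejerConst m k ≤ fejerConst m' k := by
  rw [fejerConst_eq hm, fejerConst_eq (by lia)]
  refine cos_pi_div_le_cos_pi_div (by norm_cast; lia) ?_
  gcongr

theorem fejerConst_nonneg {m : ℕ} (hm : m ≠ 0) (k : ℕ) : 0 ≤ fejerConst m k := by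
  rw [fejerConst_eq hm, ← Real.cos_pi_div_two]
  exact cos_pi_div_le_cos_pi_div one_le_two (by norm_cast; lia)

theorem half_le_fejerConst {m k : ℕ} (hk : k ≠ 0) (hkm : k < m) : 1 / 2 ≤ fejerConst m k := by
  have hdiv : 1 ≤ (m - 1) / k := (Nat.one_le_div_iff hk.pos).2 (by lia)
  rw [fejerConst_eq (by lia), ← Real.cos_pi_div_three]
  exact cos_pi_div_le_cos_pi_div (by norm_num) (by norm_cast; lia)

theorem fejerConst_le_one (m k : ℕ) : fejerConst m k ≤ 1 :=
  Real.cos_le_one _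

theorem tendsto_fejerConst {k : ℕ} (hk : k ≠ 0) :
    Tendsto (fun m => fejerConst m k) atTop (nhds 1) := by
  have hdiv : Tendsto (fun m : ℕ => (m - 1) / k + 2) atTop atTop :=
    (tendsto_add_atTop_nat 2).comp
      ((Nat.tendsto_div_const_atTop hk).comp (tendsto_sub_atTop_nat 1))
  have hcos := (Real.continuous_cos.tendsto 0).comp
    ((tendsto_const_div_atTop_nhds_zero_nat Real.pi).comp hdiv)
  rw [Real.cos_zero] at hcos
  refine hcos.congr' ?_
  filter_upwards [eventually_ne_atTop 0] with m hm
  exact (fejerConst_eq hm k).symm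

/-- The polynomial `∑_{k=1}^{m-1} t^k cos (π / ([(m-1)/k] + 2))`, which takes the value `1 / 2`
at the Bohr radius `t_m`. -/
def fejerPoly (m : ℕ) (t : ℝ) : ℝ :=
  ∑ k ∈ Icc 1 (m - 1), t ^ k * fejerConst m k

theorem fejerPoly_strictMonoOn {m : ℕ} (hm : 2 ≤ m) :
    StrictMonoOn (fejerPoly m) (Set.Ici 0) := by
  intro s hs t _ hst
  refine sum_lt_sum_of_nonempty (nonempty_Icc.2 (by lia)) fun k hk => ?_
  rw [mem_Icc] at hk
  exact mul_lt_mul_of_pos_right (pow_lt_pow_left₀ hst hs (by lia))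
    (one_half_pos.trans_le (half_le_fejerConst (by lia) (by lia)))

theorem fejerPoly_zero (m : ℕ) : fejerPoly m 0 = 0 :=
  sum_eq_zero fun k hk => by
    rw [zero_pow (by have := mem_Icc.1 hk; lia), zero_mul]

theorem half_le_fejerPoly_one {m : ℕ} (hm : 2 ≤ m) : 1 / 2 ≤ fejerPoly m 1 :=
  calc 1 / 2 ≤ fejerConst m 1 := half_le_fejerConst one_ne_zero (by lia)
    _ = 1 ^ 1 * fejerConst m 1 := by rw [one_pow, one_mul]
    _ ≤ fejerPoly m 1 := single_le_sum (f := fun k => (1 : ℝ) ^ k * fejerConst m k)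
        (fun k _ => mul_nonneg (by positivity) (fejerConst_nonneg (by lia) k))
        (mem_Icc.2 ⟨le_rfl, by lia⟩)

theorem fejerPoly_lt_fejerPoly {m m' : ℕ} (hm : m ≠ 0) (h : m < m') {t : ℝ} (ht : 0 < t) :
    fejerPoly m t < fejerPoly m' t := by
  calc fejerPoly m t ≤ ∑ k ∈ Icc 1 (m - 1), t ^ k * fejerConst m' k := by
        unfold fejerPoly
        gcongr with k
        exact fejerConst_mono hm h.le k
    _ < fejerPoly m' t := by
        refine sum_lt_sum_of_subset (Icc_subset_Icc_right (by lia)) (i := m' - 1)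
          (mem_Icc.2 ⟨by lia, le_rfl⟩) (by rw [mem_Icc]; lia) ?_
          fun k _ _ => mul_nonneg (by positivity) (fejerConst_nonneg (by lia) k)
        exact mul_pos (by positivity)
          (one_half_pos.trans_le (half_le_fejerConst (by lia) (by lia)))

theorem sum_Icc_one_third_pow (n : ℕ) :
    ∑ k ∈ Icc 1 n, (1 / 3 : ℝ) ^ k = 1 / 2 - (1 / 3) ^ n / 2 := by
  induction n with
  | zero => norm_num
  | succ n ih =>
    rw [sum_Icc_succ_top (by lia), ih]
    ring

theorem fejerPoly_one_third_lt (m : ℕ) : fejerPoly m (1 / 3) < 1 / 2 :=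
  calc fejerPoly m (1 / 3) ≤ ∑ k ∈ Icc 1 (m - 1), (1 / 3 : ℝ) ^ k :=
        sum_le_sum fun k _ => mul_le_of_le_one_right (by positivity) (fejerConst_le_one m k)
    _ = 1 / 2 - (1 / 3) ^ (m - 1) / 2 := sum_Icc_one_third_pow _
    _ < 1 / 2 := sub_lt_self _ (by positivity)

theorem exists_half_lt_sum_Icc_pow {s : ℝ} (hs : 1 / 3 < s) :
    ∃ n : ℕ, 1 / 2 < ∑ k ∈ Icc 1 n, s ^ k := by
  obtain ⟨n, hn⟩ := exists_pow_lt_of_lt_one (sub_pos.2 hs) (y := (1 / 3 : ℝ)) (by norm_num)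
  have hpow : (1 / 3 : ℝ) ^ (n + 1) ≤ (1 / 3) ^ n :=
    pow_le_pow_of_le_one (by norm_num) (by norm_num) n.le_succ
  have hfirst : s - 1 / 3 ≤ ∑ k ∈ Icc 1 (n + 1), (s ^ k - (1 / 3) ^ k) := by
    have hterm (k : ℕ) : 0 ≤ s ^ k - (1 / 3) ^ k :=
      sub_nonneg.2 (pow_le_pow_left₀ (by norm_num) hs.le k)
    simpa only [pow_one] using
      single_le_sum (fun k _ => hterm k) (left_mem_Icc.2 (Nat.succ_le_succ n.zero_le))
  rw [sum_sub_distrib, sum_Icc_one_third_pow] at hfirst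
  have : (0 : ℝ) < (1 / 3) ^ n := by positivity
  exact ⟨n + 1, by linarith⟩

theorem eventually_half_lt_fejerPoly {s : ℝ} (hs : 1 / 3 < s) :
    ∀ᶠ m in atTop, 1 / 2 < fejerPoly m s := by
  have : 0 < s := by linarith
  obtain ⟨n, hn⟩ := exists_half_lt_sum_Icc_pow hs
  have hlim : Tendsto (fun m => ∑ k ∈ Icc 1 n, s ^ k * fejerConst m k) atTop
      (nhds (∑ k ∈ Icc 1 n, s ^ k * 1)) :=
    tendsto_finsetSum _ fun k hk =>
      (tendsto_fejerConst (by have := mem_Icc.1 hk; lia)).const_mul _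
  simp only [mul_one] at hlim
  filter_upwards [hlim.eventually_const_lt hn, eventually_gt_atTop n] with m hm hnm
  exact hm.trans_le (sum_le_sum_of_subset_of_nonneg (Icc_subset_Icc_right (by lia)) fun k _ _ =>
    mul_nonneg (by positivity) (fejerConst_nonneg (by lia) k))

/-- The Bohr radius `t_m`: the root in `(0, 1]` of `fejerPoly m t = 1 / 2`, unspecified for
`m ≤ 1`. -/
def fejerRoot (m : ℕ) : ℝ :=
  Function.invFunOn (fejerPoly m) (Set.Ioc 0 1) (1 / 2)

theorem half_mem_image_fejerPoly {m : ℕ} (hm : 2 ≤ m) :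
    1 / 2 ∈ fejerPoly m '' Set.Ioc 0 1 := by
  have hcont : ContinuousOn (fejerPoly m) (Set.Icc 0 1) := by unfold fejerPoly; fun_prop
  refine intermediate_value_Ioc zero_le_one hcont ⟨?_, half_le_fejerPoly_one hm⟩
  rw [fejerPoly_zero]
  exact one_half_pos

theorem fejerRoot_mem_Ioc {m : ℕ} (hm : 2 ≤ m) : fejerRoot m ∈ Set.Ioc 0 1 :=
  Function.invFunOn_mem (half_mem_image_fejerPoly hm)

theorem fejerPoly_fejerRoot {m : ℕ} (hm : 2 ≤ m) : fejerPoly m (fejerRoot m) = 1 / 2 :=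
  Function.invFunOn_eq (half_mem_image_fejerPoly hm)

theorem lt_fejerRoot_iff {m : ℕ} (hm : 2 ≤ m) {s : ℝ} (hs : 0 ≤ s) :
    s < fejerRoot m ↔ fejerPoly m s < 1 / 2 := by
  rw [← fejerPoly_fejerRoot hm,
    (fejerPoly_strictMonoOn hm).lt_iff_lt hs (fejerRoot_mem_Ioc hm).1.le]

theorem fejerRoot_lt_iff {m : ℕ} (hm : 2 ≤ m) {s : ℝ} (hs : 0 ≤ s) :
    fejerRoot m < s ↔ 1 / 2 < fejerPoly m s := by
  rw [← fejerPoly_fejerRoot hm,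
    (fejerPoly_strictMonoOn hm).lt_iff_lt (fejerRoot_mem_Ioc hm).1.le hs]

theorem eq_fejerRoot_iff {m : ℕ} (hm : 2 ≤ m) {s : ℝ} (hs : 0 ≤ s) :
    s = fejerRoot m ↔ fejerPoly m s = 1 / 2 := by
  rw [← fejerPoly_fejerRoot hm,
    (fejerPoly_strictMonoOn hm).injOn.eq_iff hs (fejerRoot_mem_Ioc hm).1.le]

theorem fejerRoot_strictAntiOn : StrictAntiOn fejerRoot (Set.Ici 2) := by
  intro a (ha : 2 ≤ a) b (hb : 2 ≤ b) hab
  have ha0 := (fejerRoot_mem_Ioc ha).1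
  rw [fejerRoot_lt_iff hb ha0.le, ← fejerPoly_fejerRoot ha]
  exact fejerPoly_lt_fejerPoly (by lia) hab ha0

theorem tendsto_fejerRoot : Tendsto fejerRoot atTop (nhds (1 / 3)) := by
  rw [tendsto_order]
  refine ⟨fun a ha => ?_, fun a ha => ?_⟩
  · filter_upwards [eventually_ge_atTop 2] with m hm
    exact ha.trans ((lt_fejerRoot_iff hm (by norm_num)).2 (fejerPoly_one_third_lt m))
  · filter_upwards [eventually_half_lt_fejerPoly ha, eventually_ge_atTop 2] with m hm hm2
    exact (fejerRoot_lt_iff hm2 (by linarith)).2 hm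

end FejerRoot

section Tensor

variable {E F H : Type*} [NormedAddCommGroup E] [InnerProductSpace ℂ E]
  [NormedAddCommGroup F] [InnerProductSpace ℂ F] [NormedAddCommGroup H] [InnerProductSpace ℂ H]

theorem HilbertTensor.clm_ext {G : Type*} [NormedAddCommGroup G] [NormedSpace ℂ G]
    {S T : HilbertTensor E H →L[ℂ] G}
    (h : ∀ (x : E) (y : H), S (x ⊗ₜ[ℂ] y : E ⊗[ℂ] H) = T (x ⊗ₜ[ℂ] y : E ⊗[ℂ] H)) : S = T := by
  refine DFunLike.coe_injective
    (UniformSpace.Completion.ext S.continuous T.continuous fun z => ?_)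
  induction z with
  | zero => rw [UniformSpace.Completion.coe_zero, map_zero, map_zero]
  | add z z' hz hz' => rw [UniformSpace.Completion.coe_add, map_add, map_add, hz, hz']
  | tmul x y => exact h x y

theorem opTensor_tmul (T : E →L[ℂ] E) (A : H →L[ℂ] H) (x : E) (y : H) :
    opTensor T A (x ⊗ₜ[ℂ] y : E ⊗[ℂ] H) = (T x ⊗ₜ[ℂ] A y : E ⊗[ℂ] H) := by
  rw [opTensor, ContinuousLinearMap.completion_apply_coe, TensorProduct.mapL_tmul]

theorem opTensor_smul_left (c : ℂ) (T : E →L[ℂ] E) (A : H →L[ℂ] H) :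
    opTensor (c • T) A = c • opTensor T A :=
  HilbertTensor.clm_ext fun x y => by
    simp only [smul_apply, opTensor_tmul, ← UniformSpace.Completion.coe_smul,
      TensorProduct.smul_tmul']

theorem opTensor_sub_right (T : E →L[ℂ] E) (A B : H →L[ℂ] H) :
    opTensor T (A - B) = opTensor T A - opTensor T B :=
  HilbertTensor.clm_ext fun x y => by
    simp only [sub_apply, opTensor_tmul, ← UniformSpace.Completion.coe_sub,
      TensorProduct.tmul_sub]

theorem opTensor_one_one : opTensor (1 : E →L[ℂ] E) (1 : H →L[ℂ] H) = 1 :=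
  HilbertTensor.clm_ext fun x y => by
    simp only [opTensor_tmul, one_apply_eq_self]

theorem norm_completion_le {𝕜 V W : Type*} [NontriviallyNormedField 𝕜]
    [NormedAddCommGroup V] [NormedSpace 𝕜 V]
    [NormedAddCommGroup W] [NormedSpace 𝕜 W] (T : V →L[𝕜] W) : ‖T.completion‖ ≤ ‖T‖ := by
  refine ContinuousLinearMap.opNorm_le_bound _ (norm_nonneg _) fun z => ?_
  induction z using UniformSpace.Completion.induction_on with
  | hp => exact isClosed_le T.completion.continuous.norm (continuous_const.mul continuous_norm)
  | ih v =>
    rw [ContinuousLinearMap.completion_apply_coe, UniformSpace.Completion.norm_coe,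
      UniformSpace.Completion.norm_coe]
    exact T.le_opNorm v

theorem norm_opTensor_le (T : E →L[ℂ] E) (A : H →L[ℂ] H) : ‖opTensor T A‖ ≤ ‖T‖ * ‖A‖ :=
  (norm_completion_le _).trans (TensorProduct.norm_mapL_le T A)

/-- The isometry `U ⊗ 1` of Hilbert tensor products, for an isometry `U`. -/
def isoTensor (H : Type*) [NormedAddCommGroup H] [InnerProductSpace ℂ H] (U : E →ₗᵢ[ℂ] F) :
    HilbertTensor E H →ₗᵢ[ℂ] HilbertTensor F H where
  toLinearMap := ((U.rTensor H).toContinuousLinearMap.completion).toLinearMap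
  norm_map' := (AddMonoidHomClass.isometry_iff_norm
    ((U.rTensor H).toContinuousLinearMap.completion)).1 (U.rTensor H).isometry.completion_map

theorem isoTensor_tmul (U : E →ₗᵢ[ℂ] F) (x : E) (y : H) :
    isoTensor H U (x ⊗ₜ[ℂ] y : E ⊗[ℂ] H) = (U x ⊗ₜ[ℂ] y : F ⊗[ℂ] H) :=
  ContinuousLinearMap.completion_apply_coe (U.rTensor H).toContinuousLinearMap _

theorem opTensor_comp_isoTensor {U : E →ₗᵢ[ℂ] F} {T : F →L[ℂ] F} {T' : E →L[ℂ] E}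
    (h : T ∘L U.toContinuousLinearMap = U.toContinuousLinearMap ∘L T') (A : H →L[ℂ] H) :
    opTensor T A ∘L (isoTensor H U).toContinuousLinearMap =
      (isoTensor H U).toContinuousLinearMap ∘L opTensor T' A :=
  HilbertTensor.clm_ext fun x y => by
    have hx : T (U x) = U (T' x) := congr($h x)
    simp only [ContinuousLinearMap.comp_apply, LinearIsometry.coe_toContinuousLinearMap,
      isoTensor_tmul, opTensor_tmul, hx]

end Tensor

section HilbertBasis

variable {𝕜 X E F : Type*} [RCLike 𝕜] [NormedAddCommGroup E] [InnerProductSpace 𝕜 E]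

theorem clm_ext_hilbertBasis (b : HilbertBasis X 𝕜 E) [NormedAddCommGroup F] [NormedSpace 𝕜 F]
    {S T : E →L[𝕜] F} (h : ∀ x, S (b x) = T (b x)) : S = T :=
  ContinuousLinearMap.ext_on
    (Submodule.dense_iff_topologicalClosure_eq_top.2 b.dense_span) (Set.forall_mem_range.2 h)

theorem orthonormal_smul {v : X → E} (hv : Orthonormal 𝕜 v) {c : X → 𝕜} (hc : ∀ x, ‖c x‖ = 1) :
    Orthonormal 𝕜 fun x => c x • v x := by
  refine ⟨fun x => ?_, fun x y hxy => ?_⟩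
  · rw [norm_smul, hc, hv.1, one_mul]
  · change inner 𝕜 (c x • v x) (c y • v y) = 0
    rw [inner_smul_left, inner_smul_right, hv.2 hxy, mul_zero, mul_zero]

variable [NormedAddCommGroup F] [InnerProductSpace 𝕜 F] [CompleteSpace F]

/-- The isometry that sends the vectors of a Hilbert basis to those of an orthonormal family. -/
def hilbertBasisLift (b : HilbertBasis X 𝕜 E) {v : X → F} (hv : Orthonormal 𝕜 v) : E →ₗᵢ[𝕜] F :=
  hv.orthogonalFamily.linearIsometry.comp b.repr.toLinearIsometry

theorem hilbertBasisLift_apply (b : HilbertBasis X 𝕜 E) {v : X → F} (hv : Orthonormal 𝕜 v)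
    (x : X) : hilbertBasisLift b hv (b x) = v x := by
  classical
  rw [hilbertBasisLift, LinearIsometry.coe_comp, Function.comp_apply,
    LinearIsometryEquiv.coe_toLinearIsometry,
    b.repr_self, hv.orthogonalFamily.linearIsometry_apply_single,
    LinearIsometry.toSpanSingleton_apply, one_smul]

end HilbertBasis

section Fock

variable {ι : Type*}

/-- The orthonormal basis `(e_α)_α` of the full Fock space, indexed by the words `α`. -/
def fockBasis (ι : Type*) : HilbertBasis (FreeMonoid ι) ℂ (Fock ι) :=
  .ofRepr (.refl ℂ _)

theorem fockBasis_eq_single [DecidableEq (FreeMonoid ι)] (α : FreeMonoid ι) :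
    fockBasis ι α = lp.single 2 α (1 : ℂ) := by
  rw [← (fockBasis ι).repr_symm_single]
  rfl

theorem creation_fockBasis (i : ι) (α : FreeMonoid ι) :
    creation i (fockBasis ι α) = fockBasis ι (FreeMonoid.of i * α) := by
  classical
  ext β
  change Function.extend (FreeMonoid.of i * ·) (fockBasis ι α) 0 β = _
  by_cases hβ : ∃ γ, FreeMonoid.of i * γ = β
  · obtain ⟨γ, rfl⟩ := hβ
    simp only [(of_mul_injective i).extend_apply, fockBasis_eq_single, lp.single_apply,
      Pi.single_apply, mul_right_inj]
  · rw [Function.extend_apply' _ _ _ hβ, fockBasis_eq_single, lp.single_apply,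
      Pi.single_apply, if_neg fun h => hβ ⟨α, h.symm⟩, Pi.zero_apply]

theorem creationWord_fockBasis (α β : FreeMonoid ι) :
    creationWord α (fockBasis ι β) = fockBasis ι (α * β) := by
  induction α using FreeMonoid.inductionOn' with
  | one => rw [map_one, one_apply_eq_self, one_mul]
  | of_mul i α ih =>
    rw [map_mul, mul_apply_eq_comp, ih, mul_assoc]
    exact creation_fockBasis i (α * β)

theorem norm_creation_le (i : ι) : ‖creation i‖ ≤ 1 :=
  (creationIsometry i).norm_toContinuousLinearMap_le

/-- The gauge action of the circle on the full Fock space, sending `e_α` to `u ^ (-|α|) e_α`. -/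
def gauge (ι : Type*) (u : Circle) : Fock ι →ₗᵢ[ℂ] Fock ι :=
  hilbertBasisLift (fockBasis ι) (orthonormal_smul (fockBasis ι).orthonormal
    (c := fun α => ((u ^ α.length)⁻¹ : Circle)) fun _ => Circle.norm_coe _)

theorem creationWord_comp_gauge (α : FreeMonoid ι) (u : Circle) :
    creationWord α ∘L (gauge ι u).toContinuousLinearMap =
      (gauge ι u).toContinuousLinearMap ∘L ((u : ℂ) ^ α.length • creationWord α) :=
  clm_ext_hilbertBasis (fockBasis _) fun β => by
    have hu : (u : ℂ) ^ α.length * ((u ^ (α * β).length)⁻¹ : Circle) =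
        ((u ^ β.length)⁻¹ : Circle) := by
      rw [← Circle.coe_pow, ← Circle.coe_mul, FreeMonoid.length_mul, pow_add, mul_inv,
        mul_inv_cancel_left]
    simp only [ContinuousLinearMap.comp_apply, smul_apply,
      LinearIsometry.coe_toContinuousLinearMap, map_smul, creationWord_fockBasis, gauge,
      hilbertBasisLift_apply, smul_smul, hu]

theorem length_word {k : ℕ} (i : Fin k → ι) : (word i).length = k :=
  List.length_ofFn

theorem lift_word_injective {k : ℕ} (hk : k ≠ 0) :
    Function.Injective (FreeMonoid.lift (word : (Fin k → ι) → FreeMonoid ι)) := by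
  have hflat (β : FreeMonoid (Fin k → ι)) :
      (FreeMonoid.lift word β).toList = (β.toList.map List.ofFn).flatten := by
    rw [FreeMonoid.lift_apply, FreeMonoid.toList_prod, List.map_map]
    rfl
  have hlength (β : FreeMonoid (Fin k → ι)) :
      (β.toList.map List.ofFn).map List.length = List.replicate β.length k := by
    rw [List.map_map]
    exact List.map_eq_replicate_iff.2 fun i _ => List.length_ofFn
  intro β γ h
  have hβγ : (β.toList.map List.ofFn).flatten = (γ.toList.map List.ofFn).flatten := by
    rw [← hflat, ← hflat, h]
  have hcard : β.length = γ.length := by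
    have := congrArg List.length hβγ
    simpa only [List.length_flatten, hlength, List.sum_replicate, smul_eq_mul,
      mul_left_inj' hk] using this
  exact FreeMonoid.toList.injective (List.ofFn_injective.list_map
    (List.eq_iff_flatten_eq.2 ⟨hβγ, by rw [hlength, hlength, hcard]⟩))

/-- The isometry that regards a word whose letters are words of length `k` as a word in the
letters of those: it sends `e_β` to `e_α`, with `α` the concatenation of the letters of `β`. -/
def concatIsometry (ι : Type*) {k : ℕ} (hk : k ≠ 0) : Fock (Fin k → ι) →ₗᵢ[ℂ] Fock ι :=
  hilbertBasisLift (fockBasis (Fin k → ι))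
    ((fockBasis ι).orthonormal.comp _ (lift_word_injective hk))

theorem creationWord_comp_concatIsometry {k : ℕ} (hk : k ≠ 0) (i : Fin k → ι) :
    creationWord (word i) ∘L (concatIsometry ι hk).toContinuousLinearMap =
      (concatIsometry ι hk).toContinuousLinearMap ∘L creation i :=
  clm_ext_hilbertBasis (fockBasis _) fun β => by
    simp only [ContinuousLinearMap.comp_apply, LinearIsometry.coe_toContinuousLinearMap,
      concatIsometry, hilbertBasisLift_apply, Function.comp_apply, creation_fockBasis,
      creationWord_fockBasis, map_mul, FreeMonoid.lift_eval_of]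

end Fock

section NumericalRange

variable {E : Type*} [NormedAddCommGroup E] [InnerProductSpace ℂ E]

theorem numRadius_le {T : E →L[ℂ] E} {B : ℝ} (hB : 0 ≤ B)
    (h : ∀ x : E, ‖x‖ = 1 → ‖inner ℂ x (T x)‖ ≤ B) : numRadius T ≤ B := by
  refine Real.sSup_le ?_ hB
  rintro _ ⟨x, hx, rfl⟩
  rw [← norm_inner_symm]
  exact h x hx

theorem norm_inner_le_of_re_inner_sum_le {m k N : ℕ} (hkm : k < m) (hmN : m + k ≤ k * N)
    {P : ℕ → E →L[ℂ] E} {G : Circle → E →ₗᵢ[ℂ] E}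
    (hG : ∀ (u : Circle) (l : ℕ) (x : E), P l (G u x) = (u : ℂ) ^ l • G u (P l x))
    (h : ∀ x : E, (inner ℂ x ((∑ l ∈ Finset.range m, P l) x)).re ≤ ‖x‖ ^ 2) (x : E) :
    ‖inner ℂ x (P k x)‖ ≤
      2 * (‖x‖ ^ 2 - (inner ℂ x (P 0 x)).re) * Real.cos (Real.pi / N) := by
  refine norm_coeff_le_of_re_sum_le hkm hmN (c := fun l => inner ℂ x (P l x)) fun u => ?_
  have hu (l : ℕ) : inner ℂ (G u x) (P l (G u x)) = (u : ℂ) ^ l * inner ℂ x (P l x) := by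
    rw [hG, inner_smul_right, LinearIsometry.inner_map_map]
  simp only [← hu]
  rw [← inner_sum, ← sum_apply, ← (G u).norm_map x]
  exact h (G u x)

variable [CompleteSpace E]

theorem re_inner_realPart (T : E →L[ℂ] E) (x : E) :
    (inner ℂ x ((realPart T : E →L[ℂ] E) x)).re = (inner ℂ x (T x)).re := by
  have hstar : (inner ℂ x (star T x)).re = (inner ℂ x (T x)).re := by
    rw [ContinuousLinearMap.star_eq_adjoint, ContinuousLinearMap.adjoint_inner_right,
      ← inner_conj_symm, Complex.conj_re]
  rw [realPart_apply_coe, smul_apply, add_apply, inner_smul_right_eq_smul, inner_add_right,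
    Complex.smul_re, Complex.add_re, hstar, smul_eq_mul]
  ring

theorem re_inner_le_of_realPart_le_one {T : E →L[ℂ] E}
    (h : (realPart T : E →L[ℂ] E) ≤ 1) (x : E) : (inner ℂ x (T x)).re ≤ ‖x‖ ^ 2 := by
  have hpos := ((ContinuousLinearMap.le_def _ _).1 h).re_inner_nonneg_right x
  rw [sub_apply, inner_sub_right, map_sub, one_apply_eq_self, inner_self_eq_norm_sq,
    sub_nonneg] at hpos
  rw [← re_inner_realPart]
  exact hpos

end NumericalRange

section HomogeneousPart

variable {ι : Type*} [Fintype ι] {H : Type*} [NormedAddCommGroup H] [InnerProductSpace ℂ H]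

/-- The homogeneous part `∑_{|α|=k} S_α ⊗ A_(α)` of degree `k` of the polynomial `F(S₁, …, S_n)`
with coefficients `A_(α)`. -/
def homPart (A : FreeMonoid ι → (H →L[ℂ] H)) (k : ℕ) :
    HilbertTensor (Fock ι) H →L[ℂ] HilbertTensor (Fock ι) H :=
  ∑ i : Fin k → ι, opTensor (creationWord (word i)) (A (word i))

theorem homPart_zero (A : FreeMonoid ι → (H →L[ℂ] H)) : homPart A 0 = opTensor 1 (A 1) := by
  rw [homPart, Fintype.sum_unique, word, List.ofFn_zero, FreeMonoid.ofList_nil, map_one]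

theorem homPart_gauge (A : FreeMonoid ι → (H →L[ℂ] H)) (u : Circle) (k : ℕ)
    (x : HilbertTensor (Fock ι) H) :
    homPart A k (isoTensor H (gauge ι u) x) =
      (u : ℂ) ^ k • isoTensor H (gauge ι u) (homPart A k x) := by
  simp only [homPart, sum_apply, map_sum, Finset.smul_sum]
  refine Finset.sum_congr rfl fun i _ => ?_
  have h := opTensor_comp_isoTensor (creationWord_comp_gauge (word i) u) (A (word i))
  rw [length_word, opTensor_smul_left, ContinuousLinearMap.comp_smul] at h
  exact congr($h x)

theorem homPart_concatIsometry (A : FreeMonoid ι → (H →L[ℂ] H)) {k : ℕ} (hk : k ≠ 0)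
    (x : HilbertTensor (Fock (Fin k → ι)) H) :
    homPart A k (isoTensor H (concatIsometry ι hk) x) =
      isoTensor H (concatIsometry ι hk) ((∑ i, opTensor (creation i) (A (word i))) x) := by
  simp only [homPart, sum_apply, map_sum]
  exact Finset.sum_congr rfl fun i _ =>
    congr($(opTensor_comp_isoTensor (creationWord_comp_concatIsometry hk i) (A (word i))) x)

theorem norm_sq_sub_re_inner_homPart_zero_le (A : FreeMonoid ι → (H →L[ℂ] H))
    (x : HilbertTensor (Fock ι) H) :
    ‖x‖ ^ 2 - (inner ℂ x (homPart A 0 x)).re ≤ ‖1 - A 1‖ * ‖x‖ ^ 2 := by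
  have hnorm : ‖opTensor (1 : Fock ι →L[ℂ] Fock ι) (1 - A 1)‖ ≤ ‖1 - A 1‖ :=
    (norm_opTensor_le _ _).trans
      (mul_le_of_le_one_left (norm_nonneg _) ContinuousLinearMap.norm_id_le)
  calc ‖x‖ ^ 2 - (inner ℂ x (homPart A 0 x)).re
      = (inner ℂ x (opTensor 1 (1 - A 1) x)).re := by
        rw [opTensor_sub_right, opTensor_one_one, sub_apply, one_apply_eq_self, inner_sub_right,
          Complex.sub_re, homPart_zero]
        exact congrArg (· - _) (inner_self_eq_norm_sq (𝕜 := ℂ) x).symm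
    _ ≤ ‖x‖ * ‖opTensor 1 (1 - A 1) x‖ := re_inner_le_norm (𝕜 := ℂ) x _
    _ ≤ ‖x‖ * (‖1 - A 1‖ * ‖x‖) := by
        gcongr
        exact ContinuousLinearMap.le_of_opNorm_le _ hnorm x
    _ = ‖1 - A 1‖ * ‖x‖ ^ 2 := by ring

theorem norm_inner_homPart_le {m k : ℕ} (hk : k ≠ 0) (hkm : k < m)
    {A : FreeMonoid ι → (H →L[ℂ] H)}
    (hA : ∀ x, (inner ℂ x ((∑ l ∈ Finset.range m, homPart A l) x)).re ≤ ‖x‖ ^ 2)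
    (x : HilbertTensor (Fock ι) H) :
    ‖inner ℂ x (homPart A k x)‖ ≤ 2 * ‖1 - A 1‖ * fejerConst m k * ‖x‖ ^ 2 := by
  have hm : m ≠ 0 := by lia
  have hmN : m + k ≤ k * ((m - 1) / k + 2) := by
    have := Nat.lt_mul_div_succ (m - 1) hk.pos
    lia
  have hcos := fejerConst_nonneg hm k
  calc ‖inner ℂ x (homPart A k x)‖
      ≤ 2 * (‖x‖ ^ 2 - (inner ℂ x (homPart A 0 x)).re) * fejerConst m k := by
        rw [fejerConst_eq hm]
        exact norm_inner_le_of_re_inner_sum_le hkm hmN (homPart_gauge A) hA x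
    _ ≤ 2 * (‖1 - A 1‖ * ‖x‖ ^ 2) * fejerConst m k := by
        gcongr
        exact norm_sq_sub_re_inner_homPart_zero_le A x
    _ = 2 * ‖1 - A 1‖ * fejerConst m k * ‖x‖ ^ 2 := by ring

end HomogeneousPart

section CoeffRadius

variable {n : ℕ} {H : Type*} [NormedAddCommGroup H] [InnerProductSpace ℂ H] [CompleteSpace H]
  {A : FreeMonoid (Fin n) → (H →L[ℂ] H)}

theorem coeffRadius_le {m k : ℕ} (hk : k ≠ 0) (hkm : k < m)
    (hA : ∀ x, (inner ℂ x (polyOp m A x)).re ≤ ‖x‖ ^ 2) :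
    coeffRadius A k ≤ 2 * ‖1 - A 1‖ * fejerConst m k := by
  have hcos := fejerConst_nonneg (m := m) (by lia) k
  refine numRadius_le (by positivity) fun x hx => ?_
  simp only [ContinuousLinearMap.adjoint_adjoint]
  have h := norm_inner_homPart_le hk hkm hA (isoTensor H (concatIsometry (Fin n) hk) x)
  rwa [homPart_concatIsometry, LinearIsometry.inner_map_map, LinearIsometry.norm_map, hx,
    one_pow, mul_one] at h

variable (A) in
theorem coeffRadius_zero_le : coeffRadius A 0 ≤ ‖A 1‖ := by
  have hword (i : Fin 0 → Fin n) : word i = 1 := by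
    rw [word, List.ofFn_zero, FreeMonoid.ofList_nil]
  refine numRadius_le (norm_nonneg _) fun x hx => ?_
  simp only [hword, ContinuousLinearMap.adjoint_adjoint, Fintype.sum_unique]
  calc ‖inner ℂ x (opTensor (creation default) (A 1) x)‖
      ≤ ‖x‖ * ‖opTensor (creation default) (A 1) x‖ := norm_inner_le_norm _ _
    _ ≤ ‖x‖ * (‖creation (default : Fin 0 → Fin n)‖ * ‖A 1‖ * ‖x‖) := by
        gcongr
        exact ContinuousLinearMap.le_of_opNorm_le _ (norm_opTensor_le _ _) x
    _ ≤ ‖A 1‖ := by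
        rw [hx, one_mul, mul_one]
        exact mul_le_of_le_one_left (norm_nonneg _) (norm_creation_le _)

theorem sum_coeffRadius_le {m : ℕ} (hm : m ≠ 0)
    (hA : ∀ x, (inner ℂ x (polyOp m A x)).re ≤ ‖x‖ ^ 2)
    {r : ℝ} (hr : 0 ≤ r) (hrm : fejerPoly m r ≤ 1 / 2) :
    ∑ k ∈ Finset.range m, r ^ k * coeffRadius A k ≤ ‖A 1‖ + ‖1 - A 1‖ := by
  have hIco : Finset.Ico (0 + 1) m = Finset.Icc 1 (m - 1) := by ext; grind
  rw [Finset.range_eq_Ico, Finset.sum_eq_sum_Ico_succ_bot hm.pos, pow_zero, one_mul, hIco]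
  refine add_le_add (coeffRadius_zero_le A) ?_
  calc ∑ k ∈ Finset.Icc 1 (m - 1), r ^ k * coeffRadius A k
      ≤ ∑ k ∈ Finset.Icc 1 (m - 1), r ^ k * (2 * ‖1 - A 1‖ * fejerConst m k) := by
        gcongr with k hk
        rw [Finset.mem_Icc] at hk
        exact coeffRadius_le (by lia) (by lia) hA
    _ = 2 * ‖1 - A 1‖ * fejerPoly m r := by
        rw [fejerPoly, Finset.mul_sum]
        exact Finset.sum_congr rfl fun k _ => by ring
    _ ≤ 2 * ‖1 - A 1‖ * (1 / 2) := by gcongr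
    _ = ‖1 - A 1‖ := by ring

end CoeffRadius

end BohrPoly

end

theorem theorem2p10_general :
    ∃ t : ℕ → ℝ,
      (∀ m : ℕ, 2 ≤ m →
        0 < t m ∧ t m ≤ 1 ∧
        ∑ k ∈ Finset.Icc 1 (m - 1), t m ^ k * BohrPoly.fejerConst m k = 1 / 2 ∧
        ∀ s : ℝ, 0 < s → s ≤ 1 →
          ∑ k ∈ Finset.Icc 1 (m - 1), s ^ k * BohrPoly.fejerConst m k = 1 / 2 → s = t m) ∧
      StrictAntiOn t (Set.Ici 2) ∧
      Filter.Tendsto t Filter.atTop (nhds (1 / 3)) ∧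
      ∀ (n : ℕ) (H : Type*) [NormedAddCommGroup H] [InnerProductSpace ℂ H]
        [CompleteSpace H] (m : ℕ) (_ : 2 ≤ m) (A : FreeMonoid (Fin n) → (H →L[ℂ] H)),
        (realPart (BohrPoly.polyOp m A) :
          BohrPoly.HilbertTensor (BohrPoly.Fock (Fin n)) H →L[ℂ]
            BohrPoly.HilbertTensor (BohrPoly.Fock (Fin n)) H) ≤ 1 →
        (∀ k : ℕ, 1 ≤ k → k ≤ m - 1 →
          BohrPoly.coeffRadius A k ≤ 2 * ‖1 - A 1‖ * BohrPoly.fejerConst m k) ∧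
        ∀ r : ℝ, 0 ≤ r → r ≤ t m →
          ∑ k ∈ Finset.range m, r ^ k * BohrPoly.coeffRadius A k ≤ ‖A 1‖ + ‖1 - A 1‖ := by
  refine ⟨BohrPoly.fejerRoot, fun m hm => ?_, BohrPoly.fejerRoot_strictAntiOn,
    BohrPoly.tendsto_fejerRoot, fun n H _ _ _ m hm A hA => ?_⟩
  · obtain ⟨hpos, hle⟩ := BohrPoly.fejerRoot_mem_Ioc hm
    exact ⟨hpos, hle, BohrPoly.fejerPoly_fejerRoot hm,
      fun s hs _ h => (BohrPoly.eq_fejerRoot_iff hm hs.le).2 h⟩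
  · replace hA := BohrPoly.re_inner_le_of_realPart_le_one hA
    refine ⟨fun k hk hkm => BohrPoly.coeffRadius_le (by lia) (by lia) hA, fun r hr hrt =>
      BohrPoly.sum_coeffRadius_le (by lia) hA hr (le_of_not_gt fun h => ?_)⟩
    exact hrt.not_gt ((BohrPoly.fejerRoot_lt_iff hm hr).2 h)

theorem theorem2p10 :
    ∃ t : ℕ → ℝ,
      (∀ m : ℕ, 2 ≤ m →
        0 < t m ∧ t m ≤ 1 ∧
        ∑ k ∈ Finset.Icc 1 (m - 1), t m ^ k * BohrPoly.fejerConst m k = 1 / 2 ∧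
        ∀ s : ℝ, 0 < s → s ≤ 1 →
          ∑ k ∈ Finset.Icc 1 (m - 1), s ^ k * BohrPoly.fejerConst m k = 1 / 2 → s = t m) ∧
      StrictAntiOn t (Set.Ici 2) ∧
      Filter.Tendsto t Filter.atTop (nhds (1 / 3)) ∧
      ∀ (n : ℕ) (_ : 1 ≤ n) (H : Type*) [NormedAddCommGroup H] [InnerProductSpace ℂ H]
        [CompleteSpace H] (m : ℕ) (_ : 2 ≤ m) (A : FreeMonoid (Fin n) → (H →L[ℂ] H)),
        0 ≤ A 1 →
        (realPart (BohrPoly.polyOp m A) :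
          BohrPoly.HilbertTensor (BohrPoly.Fock (Fin n)) H →L[ℂ]
            BohrPoly.HilbertTensor (BohrPoly.Fock (Fin n)) H) ≤ 1 →
        (∀ k : ℕ, 1 ≤ k → k ≤ m - 1 →
          BohrPoly.coeffRadius A k ≤ 2 * ‖1 - A 1‖ * BohrPoly.fejerConst m k) ∧
        ∀ r : ℝ, 0 ≤ r → r ≤ t m →
          ∑ k ∈ Finset.range m, r ^ k * BohrPoly.coeffRadius A k ≤ ‖A 1‖ + ‖1 - A 1‖ := by
  obtain ⟨t, hroot, hanti, hlim, hbohr⟩ := theorem2p10_general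
  exact ⟨t, hroot, hanti, hlim, fun n _ H _ _ _ m hm A _ => hbohr n H m hm A⟩
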